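/- \textbf{Setting.} A network polymatrix game $\mathcal G$ consists of a finite set of agents $\mathcal N$, for each agent $k$ a finite nonempty action set $S_k$, a simple undirected graph on $\mathcal N$ with edge set $\mathcal E$ (symmetric, containing $(k,l)$ and $(l,k)$ together, without loops) and adjacency matrix $G$, and, for each $(k,l)\in\mathcal E$, a real $|S_k|\times|S_l|$ payoff matrix $A^{kl}$. Let $\Delta=\prod_k\Delta(S_k)$ be the set of joint mixed strategies and $\Delta^\circ=\{\mathbf x\in\Delta : x_{ki}>0 \text{ for all } k,i\}$. The payoffs are $u_k(\mathbf x)=\sum_{l:(k,l)\in\mathcal E}\mathbf x_k\cdot A^{kl}\mathbf x_l$, and the rewards are $r_{ki}(\mathbf x)=\partial u_k(\mathbf x)/\partial x_{ki}$. Given exploration rates $(T_k)_{k\in\mathcal N}$, the perturbed game $\mathcal G^H$ has the payoffs $u_k^H(\mathbf x)=u_k(\mathbf x)-T_k\sum_i x_{ki}\ln x_{ki}$ and the pseudo-gradient $F(\mathbf x)=(-D_{\mathbf x_k}u_k^H(\mathbf x))_k$. It is called strongly monotone if there is $\alpha>0$ with $\langle F(\mathbf x)-F(\mathbf y),\mathbf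 x-\mathbf y\rangle\ge\alpha\|\mathbf x-\mathbf y\|_2^2$ for all $\mathbf x,\mathbf y\in\Delta^\circ$ (where $F$ is defined). A quantal response equilibrium (QRE) is a point $\bar{\mathbf x}\in\Delta$ with $$\bar x_{ki}=\frac{\exp(r_{ki}(\bar{\mathbf x})/T_k)}{\sum_{j\in S_k}\exp(r_{kj}(\bar{\mathbf x})/T_k)}\quad\text{for all }k\in\mathcal N,\ i\in S_k.$$ The Q-learning dynamics (QLD) are the differential equations, for $\mathbf x:[0,\infty)\to\Delta^\circ$, $$\frac{\dot x_{ki}}{x_{ki}}=r_{ki}(\mathbf x)-\langle\mathbf x_k,r_k(\mathbf x)\rangle+T_k\sum_{j\in S_k}x_{kj}\ln\frac{x_{kj}}{x_{ki}}.$$ Let $\delta_S=\max_{(k,l)\in\mathcal E}\|A^{kl}+(A^{lk})^\top\|_2$ (operator $2$-norm; $\delta_S=0$ if there are no edges) and $\|G\|_\infty=\max_k\sum_l|G_{kl}|$, the maximum degree. \textbf{Theorem.} Suppose that $T_k>\tfrac12\,\delta_S\,\|G\|_\infty$ for every agent $k$. Then 1. the perturbed game $\mathcal G^H$ is strongly monotone;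 2. $\mathcal G$ has exactly one QRE $\bar{\mathbf x}\in\Delta$; 3. the Q-learning dynamics converge to it: from every initial condition in $\Delta^\circ$ there is a solution of (QLD) on $[0,\infty)$, and every solution $\mathbf x(t)$ of (QLD) on $[0,\infty)$ satisfies $\mathbf x(t)\to\bar{\mathbf x}$ as $t\to\infty$. -/

import Mathlib

open Filter Topology

/-- A network polymatrix game with (finite) player set `V` and action sets `S k`: an undirected
graph and, for every ordered pair of players, a payoff matrix.  Only the matrices `A k l` with
`k`, `l` adjacent are ever used. -/
structure NetworkGame (V : Type*) (S : V → Type*) where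
  graph : SimpleGraph V
  A : ∀ k l : V, Matrix (S k) (S l) ℝ

/-- The Euclidean space that contains the joint strategies; `x ⟨k, i⟩` is the coordinate
`x_{ki}`. -/
abbrev Profile {V : Type*} (S : V → Type*) : Type _ := EuclideanSpace ℝ (Σ k, S k)

/-- The strategy `x_k` of player `k`, extracted from the joint strategy `x`. -/
def Profile.strat {V : Type*} {S : V → Type*} (x : Profile S) (k : V) : S k → ℝ :=
  fun i => x ⟨k, i⟩

section GeneralGames

variable {V : Type*} [Fintype V] [DecidableEq V]
  {S : V → Type*} [∀ k, Fintype (S k)] [∀ k, DecidableEq (S k)]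

/-- The set `Δ = ×_k Δ(S_k)` of joint mixed strategies. -/
def mixedProfiles (S : V → Type*) [∀ k, Fintype (S k)] : Set (Profile S) :=
  {x | ∀ k, x.strat k ∈ stdSimplex ℝ (S k)}

/-- The relative interior of `Δ`: the fully mixed joint strategies. -/
def fullyMixedProfiles (S : V → Type*) [∀ k, Fintype (S k)] : Set (Profile S) :=
  {x | x ∈ mixedProfiles S ∧ ∀ a, 0 < x a}

/-- The partial derivative `∂u_k / ∂x_{ki}` at `x`. -/
noncomputable def ownPartial (u : V → Profile S → ℝ) (k : V) (i : S k) (x : Profile S) : ℝ :=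
  lineDeriv ℝ (u k) x (EuclideanSpace.single ⟨k, i⟩ (1 : ℝ))

/-- The pseudo-gradient map `F(x) = (-D_{x_k} u_k(x))_k` of the game with payoffs `u`. -/
noncomputable def pseudoGradient (u : V → Profile S → ℝ) (x : Profile S) : Profile S :=
  WithLp.toLp 2 fun a => -ownPartial u a.1 a.2 x

/-- The payoffs of the perturbed game with exploration rates `T`:
`u_k^H(x) = u_k(x) - T_k ⟨x_k, ln x_k⟩`. -/
noncomputable def perturbedPayoff (u : V → Profile S → ℝ) (T : V → ℝ) (k : V) (x : Profile S) :
    ℝ :=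
  u k x - T k * ∑ i, x ⟨k, i⟩ * Real.log (x ⟨k, i⟩)

/-- Strong monotonicity of `F` on the set `X` with constant `α`. -/
def StronglyMonotoneOnWith {ι : Type*} [Fintype ι] (F : EuclideanSpace ℝ ι → EuclideanSpace ℝ ι)
    (X : Set (EuclideanSpace ℝ ι)) (α : ℝ) : Prop :=
  0 < α ∧ ∀ x ∈ X, ∀ y ∈ X, α * ‖x - y‖ ^ 2 ≤ inner ℝ (F x - F y) (x - y)

/-- Quantal response equilibrium of the game with payoffs `u` at exploration rates `T`.  The reward
`r_{ki}` is the partial derivative `∂u_k / ∂x_{ki}`. -/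
def IsQRE (u : V → Profile S → ℝ) (T : V → ℝ) (x : Profile S) : Prop :=
  x ∈ mixedProfiles S ∧
    ∀ (k : V) (i : S k),
      x ⟨k, i⟩ = Real.exp (ownPartial u k i x / T k) / ∑ j, Real.exp (ownPartial u k j x / T k)

/-- The right-hand side of the equation for `ẋ_{ki} / x_{ki}` in the Q-learning dynamics. -/
noncomputable def qldRate (u : V → Profile S → ℝ) (T : V → ℝ) (k : V) (i : S k) (x : Profile S) :
    ℝ :=
  ownPartial u k i x - ∑ j, x ⟨k, j⟩ * ownPartial u k j x
    + T k * ∑ j, x ⟨k, j⟩ * Real.log (x ⟨k, j⟩ / x ⟨k, i⟩)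

/-- `x : [0, ∞) → Δ` is a solution of the Q-learning dynamics.  The equation involves
`ẋ_{ki} / x_{ki}` and `ln (x_{kj} / x_{ki})`, so its solutions live in the fully mixed strategies.
The values of `x` at negative times are irrelevant. -/
def IsQLDSolution (u : V → Profile S → ℝ) (T : V → ℝ) (x : ℝ → Profile S) : Prop :=
  ∀ t : ℝ, 0 ≤ t → x t ∈ fullyMixedProfiles S ∧
    ∀ (k : V) (i : S k), ∃ v : ℝ,
      HasDerivWithinAt (fun s => x s ⟨k, i⟩) v (Set.Ici 0) t ∧
        v / x t ⟨k, i⟩ = qldRate u T k i (x t)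

end GeneralGames

namespace NetworkGame

variable {V : Type*} [Fintype V] [DecidableEq V]
  {S : V → Type*} [∀ k, Fintype (S k)] [∀ k, DecidableEq (S k)]

/-- The payoff `u_k(x) = ∑_{(k,l) ∈ E} x_k · A^{kl} x_l`. -/
noncomputable def payoff (𝒢 : NetworkGame V S) [DecidableRel 𝒢.graph.Adj] (k : V)
    (x : Profile S) : ℝ :=
  ∑ l with 𝒢.graph.Adj k l, x.strat k ⬝ᵥ (𝒢.A k l).mulVec (x.strat l)

open scoped Matrix.Norms.L2Operator in
/-- The interaction coefficient `δ_S = max_{(k,l) ∈ E} ‖A^{kl} + (A^{lk})ᵀ‖₂`, with the operator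
`2`-norm; it is `0` for a graph without edges. -/
noncomputable def interactionCoeff (𝒢 : NetworkGame V S) : ℝ :=
  ⨆ e : {e : V × V // 𝒢.graph.Adj e.1 e.2}, ‖𝒢.A e.1.1 e.1.2 + (𝒢.A e.1.2 e.1.1).transpose‖

open scoped Matrix.Norms.Operator in
/-- `‖G‖_∞ = max_i ∑_j |G_{ij}|` for the adjacency matrix `G`: the operator norm for the
sup norm on vectors. -/
noncomputable def adjInftyNorm (𝒢 : NetworkGame V S) [DecidableRel 𝒢.graph.Adj] : ℝ :=
  ‖𝒢.graph.adjMatrix ℝ‖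

end NetworkGame

/-! The rewards are a linear map `R` of the profile, and up to an additive constant vector the
pseudo-gradient of the perturbed game is F(x) = T log x - R x. Symmetrising over edges gives ⟨R d,
d⟩ ≤ c‖d‖² with c = ½ δ_S ‖G‖_∞ (`inner_rewardMap_le`), while log is strongly monotone with constant
1 on (0, 1]. Hence T_k ≥ c + α leaves a surplus α (`mul_sum_log_sub_mul_sub_le`).

A QRE is a fully mixed point where F is constant on each agent's block. Block-constant vectors are
orthogonal to differences of mixed profiles, so strong monotonicity forces uniqueness. For
existence, solve the variational inequality for F on the simplices truncated at height ε, where F is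
Lipschitz; the steepness of log near 0 keeps the solution off the truncation
(`exists_isEntropicEquilibrium`).

For convergence, the relative entropy D of the QRE p with respect to x(t) satisfies D' = -⟨F(x) -
F(p), x - p⟩ ≤ -αD (`IsQLDSolution.tendsto`). The last step needs the surplus measured in
symmetrised relative entropy, not only in Euclidean norm. Global solutions come from logarithmic
coordinates, where the field grows at most linearly (`exists_isQLDSolution`). -/

/-! ### Scalar entropy inequalities, variational inequalities, complete vector fields. -/

section AnalyticTools

/-- The Bregman divergence of `p ↦ p log p` dominates half the squared distance on `(0, 1]`. -/
theorem half_sq_sub_le_mul_log_sub {p q : ℝ} (hp : 0 < p) (hp1 : p ≤ 1) (hq : 0 < q)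
    (hq1 : q ≤ 1) : (p - q) ^ 2 / 2 ≤ p * (Real.log p - Real.log q) - p + q := by
  rcases le_total q p with h | h
  -- The bound log(p/q) ≥ 2(p-q)/(p+q) leaves (p-q)²/(p+q), and p + q ≤ 2.
  · have h1 := Real.le_log_one_add_of_nonneg (x := p / q - 1)
      (by rw [sub_nonneg, le_div_iff₀ hq]; linarith)
    rw [add_sub_cancel, Real.log_div hp.ne' hq.ne'] at h1
    have h2 : 2 * (p / q - 1) / (p / q - 1 + 2) = 2 * (p - q) / (p + q) := by
      have : p / q - 1 + 2 ≠ 0 := by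
        have := div_pos hp hq
        linarith
      field_simp
      ring
    rw [h2] at h1
    have h3 := mul_le_mul_of_nonneg_left h1 hp.le
    have h4 : p * (2 * (p - q) / (p + q)) - p + q = (p - q) ^ 2 / (p + q) := by
      field_simp
      ring
    have h5 : (p - q) ^ 2 / 2 ≤ (p - q) ^ 2 / (p + q) :=
      div_le_div_of_nonneg_left (sq_nonneg _) (by linarith) (by linarith)
    linarith
  -- The bound log r ≤ (r - 1/r)/2 at r = q/p leaves (p-q)²/(2q), and q ≤ 1.
  · have h1 : Real.log (q / p) ≤ Real.sinh (Real.log (q / p)) :=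
      Real.self_le_sinh_iff.2 (Real.log_nonneg (by rw [le_div_iff₀ hp]; linarith))
    rw [Real.sinh_log (div_pos hq hp), Real.log_div hq.ne' hp.ne'] at h1
    have h3 := mul_le_mul_of_nonneg_left h1 hp.le
    have h4 : p * ((q / p - (q / p)⁻¹) / 2) = q - p - (p - q) ^ 2 / (2 * q) := by
      field_simp
      ring
    have h5 : (p - q) ^ 2 / 2 ≤ (p - q) ^ 2 / (2 * q) :=
      div_le_div_of_nonneg_left (sq_nonneg _) (by linarith) (by linarith)
    linarith

theorem sq_sub_le_log_sub_log_mul_sub {p q : ℝ} (hp : 0 < p) (hp1 : p ≤ 1) (hq : 0 < q)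
    (hq1 : q ≤ 1) : (p - q) ^ 2 ≤ (Real.log p - Real.log q) * (p - q) := by
  have h1 := half_sq_sub_le_mul_log_sub hp hp1 hq hq1
  have h2 := half_sq_sub_le_mul_log_sub hq hq1 hp hp1
  linarith

/-- A strongly monotone Lipschitz map has a zero in the sense of variational inequalities on every
complete nonempty convex set. -/
theorem exists_forall_inner_nonneg_of_strongly_monotone {E : Type*} [NormedAddCommGroup E]
    [InnerProductSpace ℝ E] {K : Set E} (hne : K.Nonempty) (hcomp : IsComplete K)
    (hconv : Convex ℝ K) {F : E → E} {L : NNReal} (hL : LipschitzOnWith L F K) {α : ℝ}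
    (hα : 0 < α)
    (hF : ∀ x ∈ K, ∀ y ∈ K, α * ‖x - y‖ ^ 2 ≤ inner ℝ (F x - F y) (x - y)) :
    ∃ x ∈ K, ∀ y ∈ K, 0 ≤ inner ℝ (F x) (y - x) := by
  have hproj : ∀ u : E, ∃ v ∈ K, ∀ w ∈ K, inner ℝ (u - v) (w - v) ≤ 0 := fun u => by
    obtain ⟨v, hv, h⟩ := exists_norm_eq_iInf_of_complete_convex hne hcomp hconv u
    exact ⟨v, hv, (norm_eq_iInf_iff_real_inner_le_zero hconv hv).1 h⟩
  choose P hPK hP using hproj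
  have hPnon : ∀ u v, ‖P u - P v‖ ≤ ‖u - v‖ := fun u v => by
    have h1 := hP u (P v) (hPK v)
    have h2 := hP v (P u) (hPK u)
    have h3 : ‖P u - P v‖ ^ 2 ≤ inner ℝ (u - v) (P u - P v) := by
      rw [← real_inner_self_eq_norm_sq]
      have e1 : inner ℝ (u - P u) (P v - P u) = - inner ℝ (u - P u) (P u - P v) := by
        rw [← inner_neg_right, neg_sub]
      have e2 : inner ℝ (u - v) (P u - P v) = inner ℝ (u - P u) (P u - P v)
          + inner ℝ (P u - P v) (P u - P v) - inner ℝ (v - P v) (P u - P v) := by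
        rw [← inner_add_left, ← inner_sub_left]
        congr 1
        abel
      linarith
    have h4 := real_inner_le_norm (u - v) (P u - P v)
    by_contra! h
    nlinarith [norm_nonneg (u - v), norm_nonneg (P u - P v)]
  -- A step γ contracts squared distances by 1 - 2γα + γ²M², which is least at γ = α/M². Adding α to
  -- L makes M positive and at least α, so that κ ≥ 0.
  set M : ℝ := L + α with hM
  have hM0 : 0 < M := by positivity
  set γ : ℝ := α / M ^ 2 with hγ
  have hγ0 : 0 < γ := by positivity
  set κ : ℝ := 1 - α ^ 2 / M ^ 2 with hκ
  have hκ0 : 0 ≤ κ := by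
    rw [hκ, sub_nonneg, div_le_one (by positivity)]
    exact pow_le_pow_left₀ hα.le (by rw [hM]; linarith [L.coe_nonneg]) 2
  have hκ1 : κ < 1 := by
    have : 0 < α ^ 2 / M ^ 2 := by positivity
    linarith
  have hstep : ∀ x ∈ K, ∀ y ∈ K,
      ‖P (x - γ • F x) - P (y - γ • F y)‖ ≤ Real.sqrt κ * ‖x - y‖ := fun x hx y hy => by
    refine (hPnon _ _).trans ?_
    have h1 : ‖F x - F y‖ ≤ M * ‖x - y‖ := by
      have := hL.norm_sub_le hx hy
      nlinarith [norm_nonneg (x - y)]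
    have h2 : ‖x - γ • F x - (y - γ • F y)‖ ^ 2 ≤ κ * ‖x - y‖ ^ 2 := by
      have e : x - γ • F x - (y - γ • F y) = (x - y) - γ • (F x - F y) := by
        rw [smul_sub]; abel
      rw [e, norm_sub_sq_real, norm_smul, real_inner_smul_right, real_inner_comm, mul_pow,
        Real.norm_eq_abs, sq_abs]
      have h3 := mul_le_mul_of_nonneg_left (hF x hx y hy) hγ0.le
      have h4 : ‖F x - F y‖ ^ 2 ≤ M ^ 2 * ‖x - y‖ ^ 2 := by
        rw [← mul_pow]; exact pow_le_pow_left₀ (norm_nonneg _) h1 2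
      have h5 := mul_le_mul_of_nonneg_left h4 (sq_nonneg γ)
      have h6 : γ * α = α ^ 2 / M ^ 2 := by rw [hγ]; ring
      have h7 : γ ^ 2 * M ^ 2 = α ^ 2 / M ^ 2 := by rw [hγ]; field_simp
      have h8 : γ ^ 2 * (M ^ 2 * ‖x - y‖ ^ 2) = α ^ 2 / M ^ 2 * ‖x - y‖ ^ 2 := by
        rw [← mul_assoc, h7]
      have h9 : γ * (α * ‖x - y‖ ^ 2) = α ^ 2 / M ^ 2 * ‖x - y‖ ^ 2 := by
        rw [← mul_assoc, h6]
      rw [hκ]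
      linarith
    rw [← Real.sqrt_sq (norm_nonneg (x - y)), ← Real.sqrt_mul hκ0]
    exact Real.le_sqrt_of_sq_le h2
  have hmaps : Set.MapsTo (fun x => P (x - γ • F x)) K K := fun x _ => hPK _
  have hcontr : ContractingWith (Real.sqrt κ).toNNReal (hmaps.restrict _ K K) := by
    refine ⟨?_, LipschitzWith.of_dist_le_mul fun x y => ?_⟩
    · rw [Real.toNNReal_lt_one, Real.sqrt_lt' one_pos]
      simpa using hκ1
    · rw [Real.coe_toNNReal _ (Real.sqrt_nonneg _), Subtype.dist_eq, Subtype.dist_eq, dist_eq_norm,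
        dist_eq_norm]
      exact hstep x x.2 y y.2
  obtain ⟨x₀, hx₀⟩ := hne
  -- A fixed point of the projected step x ↦ P(x - γ F x) solves the variational inequality, by the
  -- obtuse-angle property of the projection.
  obtain ⟨x, hx, hfix, -⟩ := hcontr.exists_fixedPoint' hcomp hmaps hx₀ (edist_ne_top _ _)
  refine ⟨x, hx, fun y hy => ?_⟩
  have h := hP (x - γ • F x) y hy
  have hfix' : P (x - γ • F x) = x := hfix
  rw [hfix', sub_sub_cancel_left, inner_neg_left, real_inner_smul_left] at h
  exact nonneg_of_mul_nonneg_right (by linarith) hγ0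

open scoped Manifold in
/-- A `C¹` autonomous vector field of at most linear growth is complete. -/
theorem ContDiff.exists_global_integralCurve {E : Type*} [NormedAddCommGroup E] [NormedSpace ℝ E]
    [FiniteDimensional ℝ E] {f : E → E} (hf : ContDiff ℝ 1 f) {B M : ℝ}
    (hB : ∀ x, ‖f x‖ ≤ B + M * ‖x‖) (x₀ : E) :
    ∃ γ : ℝ → E, γ 0 = x₀ ∧ ∀ t, HasDerivAt γ (f (γ t)) t := by
  have : CompleteSpace E := FiniteDimensional.complete ℝ E
  have : ProperSpace E := FiniteDimensional.proper ℝ E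
  set M' : ℝ := |M| + 1 with hM'
  have hM'0 : 0 < M' := by positivity
  set ε : ℝ := 1 / (2 * M') with hε
  have hε0 : 0 < ε := by positivity
  have hloc : ∀ x : E, ∃ γ : ℝ → E, γ 0 = x ∧
      IsMIntegralCurveOn (I := 𝓘(ℝ, E)) (M := E) γ f (Set.Ioo (-ε) ε) := fun x => by
    -- With this radius the speed on the ball is at most |B| + M'(‖x‖ + a) = 2M'a, so no curve
    -- leaves it before time ε = 1/(2M'), whatever x is. A uniform lifetime yields global curves.
    set a : ℝ := (|B| + M' * ‖x‖) / M' with ha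
    have ha0 : 0 ≤ a := by positivity
    obtain ⟨K, hK⟩ := (hf.locallyLipschitz.locallyLipschitzOn
      (s := Metric.closedBall x a)).exists_lipschitzOnWith_of_compact (isCompact_closedBall x a)
    have hbound : ∀ y ∈ Metric.closedBall x a, ‖f y‖ ≤ 2 * M' * a := fun y hy => by
      have h1 : ‖y‖ ≤ ‖x‖ + a := by
        have := norm_le_norm_add_norm_sub' y x
        rw [mem_closedBall_iff_norm] at hy
        linarith
      have h2 : M' * a = |B| + M' * ‖x‖ := by rw [ha]; field_simp
      have h3 : M * ‖y‖ ≤ M' * (‖x‖ + a) :=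
        mul_le_mul (by rw [hM']; linarith [le_abs_self M]) h1 (norm_nonneg _) hM'0.le
      linarith [hB y, le_abs_self B]
    have hPL : IsPicardLindelof (fun _ => f) (tmin := -ε) (tmax := ε)
        ⟨0, by constructor <;> linarith⟩ x a.toNNReal 0 (2 * M' * a).toNNReal K := by
      refine ⟨fun t _ => ?_, fun y _ => continuousOn_const, fun t _ y hy => ?_, ?_⟩
      · rwa [Real.coe_toNNReal _ ha0]
      · rw [Real.coe_toNNReal _ ha0] at hy
        rw [Real.coe_toNNReal _ (by positivity)]
        exact hbound y hy
      · rw [Real.coe_toNNReal _ (by positivity), Real.coe_toNNReal _ ha0]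
        simp only [sub_zero, zero_sub, neg_neg, max_self, NNReal.coe_zero]
        rw [hε]
        apply le_of_eq
        field_simp
    obtain ⟨γ, h0, h⟩ := hPL.exists_eq_forall_mem_Icc_hasDerivWithinAt₀
    refine ⟨γ, h0, fun t ht => ?_⟩
    exact (((h t (Set.Ioo_subset_Icc_self ht)).mono
      Set.Ioo_subset_Icc_self).hasFDerivWithinAt).hasMFDerivWithinAt
  obtain ⟨γ, h0, h⟩ := exists_isMIntegralCurve_of_isMIntegralCurveOn (I := 𝓘(ℝ, E)) (M := E)
    (v := f) (contMDiff_vectorSpace_iff_contDiff.2 hf) hε0 hloc x₀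
  refine ⟨γ, h0, fun t => ?_⟩
  have h1 : HasFDerivAt γ ((1 : ℝ →L[ℝ] ℝ).smulRight (f (γ t))) t := (h t).hasFDerivAt
  simpa using h1.hasDerivAt

end AnalyticTools

/-! ### Existence and uniqueness of the equilibrium for linear rewards. -/

section LinearRewards

variable {V : Type*} {S : V → Type*} [∀ k, Fintype (S k)]

theorem le_one_of_mem_fullyMixedProfiles {x : Profile S} (hx : x ∈ fullyMixedProfiles S)
    (a : Σ k, S k) : x a ≤ 1 := by
  have h := (hx.1 a.1).2
  rw [← h]
  exact Finset.single_le_sum (f := x.strat a.1) (fun i _ => (hx.1 a.1).1 i) (Finset.mem_univ a.2)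

theorem sum_eq_one_of_mem_mixedProfiles {x : Profile S} (hx : x ∈ mixedProfiles S) (k : V) :
    ∑ i, x ⟨k, i⟩ = 1 :=
  (hx k).2

/-- The mixed profiles that give probability at least `ε` to every action. -/
def truncatedProfiles (S : V → Type*) [∀ k, Fintype (S k)] (ε : ℝ) : Set (Profile S) :=
  {x | x ∈ mixedProfiles S ∧ ∀ a, ε ≤ x a}

theorem isClosed_mixedProfiles : IsClosed (mixedProfiles S) := by
  have : mixedProfiles S = ⋂ k, (fun x : Profile S => x.strat k) ⁻¹' stdSimplex ℝ (S k) := by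
    ext x; simp [mixedProfiles]
  rw [this]
  refine isClosed_iInter fun k => (isClosed_stdSimplex ℝ (S k)).preimage ?_
  unfold Profile.strat
  fun_prop

theorem isClosed_truncatedProfiles (ε : ℝ) : IsClosed (truncatedProfiles S ε) := by
  refine isClosed_mixedProfiles.inter (s₂ := {x : Profile S | ∀ a, ε ≤ x a}) ?_
  simp only [Set.ofPred_forall]
  exact isClosed_iInter fun a => isClosed_le continuous_const (by fun_prop)

theorem convex_truncatedProfiles (ε : ℝ) : Convex ℝ (truncatedProfiles S ε) := by
  intro x hx y hy a b ha hb hab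
  refine ⟨fun k => convex_stdSimplex ℝ (S k) (hx.1 k) (hy.1 k) ha hb hab, fun i => ?_⟩
  have h1 := mul_le_mul_of_nonneg_left (hx.2 i) ha
  have h2 := mul_le_mul_of_nonneg_left (hy.2 i) hb
  have h3 : a * ε + b * ε = ε := by rw [← add_mul, hab, one_mul]
  simp only [PiLp.add_apply, PiLp.smul_apply, smul_eq_mul]
  linarith

variable [Fintype V]

theorem EuclideanSpace.real_inner_eq_sum {ι : Type*} [Fintype ι] (x y : EuclideanSpace ℝ ι) :
    inner ℝ x y = ∑ a, x a * y a := by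
  simp [PiLp.inner_apply, mul_comm]

/-- A function that is constant on every block is orthogonal to differences of mixed profiles. -/
theorem sum_mul_sub_eq_zero_of_block_const {x y : Profile S} (hx : x ∈ mixedProfiles S)
    (hy : y ∈ mixedProfiles S) {g : (Σ k, S k) → ℝ} (hg : ∀ k i j, g ⟨k, i⟩ = g ⟨k, j⟩) :
    ∑ a, g a * (x a - y a) = 0 := by
  rw [Fintype.sum_sigma]
  refine Finset.sum_eq_zero fun k _ => ?_
  rcases isEmpty_or_nonempty (S k) with h | ⟨⟨j⟩⟩
  · simp
  · have : ∀ i, g ⟨k, i⟩ * (x ⟨k, i⟩ - y ⟨k, i⟩) = g ⟨k, j⟩ * (x ⟨k, i⟩ - y ⟨k, i⟩) :=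
      fun i => by rw [hg k i j]
    simp only [this]
    rw [← Finset.mul_sum, Finset.sum_sub_distrib, sum_eq_one_of_mem_mixedProfiles hx,
      sum_eq_one_of_mem_mixedProfiles hy, sub_self, mul_zero]

theorem norm_sub_sq_le_sum_log_sub_mul_sub {x y : Profile S} (hx : x ∈ fullyMixedProfiles S)
    (hy : y ∈ fullyMixedProfiles S) :
    ‖x - y‖ ^ 2 ≤ ∑ a, (Real.log (x a) - Real.log (y a)) * (x a - y a) := by
  rw [EuclideanSpace.real_norm_sq_eq]
  exact Finset.sum_le_sum fun a _ => sq_sub_le_log_sub_log_mul_sub (hx.2 a)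
    (le_one_of_mem_fullyMixedProfiles hx a) (hy.2 a) (le_one_of_mem_fullyMixedProfiles hy a)

/-- Strong monotonicity of the entropic pseudo-gradient `T log x - R x`, measured by the symmetrised
relative entropy. -/
theorem mul_sum_log_sub_mul_sub_le {T : V → ℝ} {R : Profile S →L[ℝ] Profile S} {c α : ℝ}
    (hc : 0 ≤ c) (hR : ∀ d, inner ℝ (R d) d ≤ c * ‖d‖ ^ 2) (hT : ∀ k, c + α ≤ T k)
    {x y : Profile S} (hx : x ∈ fullyMixedProfiles S) (hy : y ∈ fullyMixedProfiles S) :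
    α * ∑ a, (Real.log (x a) - Real.log (y a)) * (x a - y a) ≤
      ∑ a, ((T a.1 * Real.log (x a) - R x a) - (T a.1 * Real.log (y a) - R y a))
        * (x a - y a) := by
  -- Bounding c‖x - y‖² by c times the symmetrised entropy lets the T-term absorb it, with α times
  -- that entropy to spare.
  have h1 : ∑ a, R (x - y) a * (x a - y a) ≤
      c * ∑ a, (Real.log (x a) - Real.log (y a)) * (x a - y a) := by
    have := hR (x - y)
    rw [EuclideanSpace.real_inner_eq_sum] at this
    exact this.trans (mul_le_mul_of_nonneg_left (norm_sub_sq_le_sum_log_sub_mul_sub hx hy) hc)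
  have h2 : (c + α) * ∑ a, (Real.log (x a) - Real.log (y a)) * (x a - y a) ≤
      ∑ a, T a.1 * ((Real.log (x a) - Real.log (y a)) * (x a - y a)) := by
    rw [Finset.mul_sum]
    exact Finset.sum_le_sum fun a _ => mul_le_mul_of_nonneg_right (hT a.1)
      ((sq_nonneg _).trans
        (sq_sub_le_log_sub_log_mul_sub (hx.2 a) (le_one_of_mem_fullyMixedProfiles hx a)
          (hy.2 a) (le_one_of_mem_fullyMixedProfiles hy a)))
  have h3 : ∑ a, ((T a.1 * Real.log (x a) - R x a) - (T a.1 * Real.log (y a) - R y a))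
        * (x a - y a) = ∑ a, T a.1 * ((Real.log (x a) - Real.log (y a)) * (x a - y a))
        - ∑ a, R (x - y) a * (x a - y a) := by
    rw [← Finset.sum_sub_distrib]
    refine Finset.sum_congr rfl fun a _ => ?_
    rw [map_sub, PiLp.sub_apply]
    ring
  rw [h3]
  linarith

/-- The balance equations that characterise the QRE with rewards `R`. -/
def IsEntropicEquilibrium (R : Profile S →L[ℝ] Profile S) (T : V → ℝ) (x : Profile S) : Prop :=
  x ∈ fullyMixedProfiles S ∧ ∀ (k : V) (i j : S k),
    T k * Real.log (x ⟨k, i⟩) - R x ⟨k, i⟩ = T k * Real.log (x ⟨k, j⟩) - R x ⟨k, j⟩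

/-- At both points F is block-constant, so ⟨F(x) - F(y), x - y⟩ = 0, and strong monotonicity leaves
no distance between them. -/
theorem IsEntropicEquilibrium.eq {T : V → ℝ} {R : Profile S →L[ℝ] Profile S} {c α : ℝ}
    (hc : 0 ≤ c) (hα : 0 < α) (hR : ∀ d, inner ℝ (R d) d ≤ c * ‖d‖ ^ 2) (hT : ∀ k, c + α ≤ T k)
    {x y : Profile S} (hx : IsEntropicEquilibrium R T x) (hy : IsEntropicEquilibrium R T y) :
    x = y := by
  have h1 := mul_sum_log_sub_mul_sub_le hc hR hT hx.1 hy.1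
  rw [sum_mul_sub_eq_zero_of_block_const hx.1.1 hy.1.1
    (g := fun a => T a.1 * Real.log (x a) - R x a - (T a.1 * Real.log (y a) - R y a))
    (fun k i j => by simp only [hx.2 k i j, hy.2 k i j])] at h1
  have h2 := norm_sub_sq_le_sum_log_sub_mul_sub hx.1 hy.1
  have h3 : ‖x - y‖ ^ 2 ≤ 0 := by
    by_contra! h
    nlinarith
  exact sub_eq_zero.1 (norm_eq_zero.1 (pow_eq_zero_iff two_ne_zero |>.1
    (le_antisymm h3 (sq_nonneg _))))

theorem norm_le_of_mem_mixedProfiles {x : Profile S} (hx : x ∈ mixedProfiles S) :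
    ‖x‖ ≤ Real.sqrt (Fintype.card V) := by
  apply Real.le_sqrt_of_sq_le
  rw [EuclideanSpace.real_norm_sq_eq, Fintype.sum_sigma]
  calc ∑ k, ∑ i, x ⟨k, i⟩ ^ 2 ≤ ∑ k : V, ∑ i, x ⟨k, i⟩ := by
        refine Finset.sum_le_sum fun k _ => Finset.sum_le_sum fun i _ => ?_
        have h0 : 0 ≤ x ⟨k, i⟩ := (hx k).1 i
        have h1 : x ⟨k, i⟩ ≤ 1 := by
          rw [← sum_eq_one_of_mem_mixedProfiles hx k]
          exact Finset.single_le_sum (f := x.strat k) (fun i _ => (hx k).1 i) (Finset.mem_univ i)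
        nlinarith
    _ = Fintype.card V := by
        simp [sum_eq_one_of_mem_mixedProfiles hx]

theorem isCompact_truncatedProfiles (ε : ℝ) : IsCompact (truncatedProfiles S ε) :=
  Metric.isCompact_of_isClosed_isBounded (isClosed_truncatedProfiles ε)
    (isBounded_iff_forall_norm_le.2 ⟨_, fun _ hx => norm_le_of_mem_mixedProfiles hx.1⟩)

/-- The solution of the variational inequality on a truncation of the strategy space that is thin
enough avoids the boundary of the truncation. -/
theorem exists_isEntropicEquilibrium [DecidableEq V] [∀ k, DecidableEq (S k)]
    [∀ k, Nonempty (S k)] {T : V → ℝ} {R : Profile S →L[ℝ] Profile S} {c α : ℝ}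
    (hc : 0 ≤ c) (hα : 0 < α) (hR : ∀ d, inner ℝ (R d) d ≤ c * ‖d‖ ^ 2)
    (hT : ∀ k, c + α ≤ T k) : ∃ x, IsEntropicEquilibrium R T x := by
  have hT0 : ∀ k, 0 < T k := fun k => by linarith [hT k]
  set B : ℝ := ‖R‖ * Real.sqrt (Fintype.card V) with hB
  have hRB : ∀ x ∈ mixedProfiles S, ∀ a, |R x a| ≤ B := fun x hx a =>
    (PiLp.norm_apply_le (R x) a).trans ((R.le_opNorm x).trans
      (mul_le_mul_of_nonneg_left (norm_le_of_mem_mixedProfiles hx) (norm_nonneg _)))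
  have hcard : ∀ k, (0 : ℝ) < Fintype.card (S k) := fun k => by
    exact_mod_cast Fintype.card_pos
  -- An action at height ε would have log-probability more than 2B/T_k below that of an action of
  -- probability at least 1/|S_k|; rewards bounded by B cannot balance such a gap.
  obtain ⟨ε, hε, hεlt⟩ : ∃ ε : ℝ, 0 < ε ∧
      ∀ k, ε < Real.exp (-(2 * B) / T k) / Fintype.card (S k) := by
    have h1 : ∀ᶠ ε : ℝ in 𝓝[>] 0, ∀ k, ε < Real.exp (-(2 * B) / T k) / Fintype.card (S k) :=
      eventually_all.2 fun k => eventually_nhdsWithin_of_eventually_nhds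
        (eventually_lt_nhds (div_pos (Real.exp_pos _) (hcard k)))
    obtain ⟨ε, h, h'⟩ := (h1.and self_mem_nhdsWithin).exists
    exact ⟨ε, h', h⟩
  have hB0 : 0 ≤ B := by positivity
  have hεcard : ∀ k, ε < 1 / Fintype.card (S k) := fun k =>
    (hεlt k).trans_le (div_le_div_of_nonneg_right (Real.exp_le_one_iff.2
      (div_nonpos_of_nonpos_of_nonneg (by linarith) (hT0 k).le)) (hcard k).le)
  have hsub : truncatedProfiles S ε ⊆ fullyMixedProfiles S := fun x hx =>
    ⟨hx.1, fun a => hε.trans_le (hx.2 a)⟩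
  set F : Profile S → Profile S := fun x =>
    WithLp.toLp 2 fun a => T a.1 * Real.log (x a) - R x a with hF
  have hFdiff : ContDiffOn ℝ 1 F (truncatedProfiles S ε) := by
    rw [contDiffOn_euclidean]
    intro a
    refine ContDiffOn.sub (contDiffOn_const.mul (ContDiffOn.log ?_ ?_)) ?_
    · exact ContDiff.contDiffOn (by fun_prop)
    · exact fun x hx => ((hsub hx).2 a).ne'
    · exact ContDiff.contDiffOn (by fun_prop)
  obtain ⟨L, hL⟩ := hFdiff.exists_lipschitzOnWith one_ne_zero (convex_truncatedProfiles ε)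
    (isCompact_truncatedProfiles ε)
  have hne : (truncatedProfiles S ε).Nonempty := by
    refine ⟨WithLp.toLp 2 fun a => 1 / (Fintype.card (S a.1) : ℝ), fun k => ⟨fun i => ?_, ?_⟩,
      fun a => (hεcard a.1).le⟩
    · simp only [Profile.strat]
      positivity
    · have := (hcard k).ne'
      change ∑ i : S k, 1 / (Fintype.card (S k) : ℝ) = 1
      rw [Finset.sum_const, Finset.card_univ, nsmul_eq_mul]
      field_simp
  have hmono : ∀ x ∈ truncatedProfiles S ε, ∀ y ∈ truncatedProfiles S ε,
      α * ‖x - y‖ ^ 2 ≤ inner ℝ (F x - F y) (x - y) := fun x hx y hy => by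
    rw [EuclideanSpace.real_inner_eq_sum]
    exact (mul_le_mul_of_nonneg_left
      (norm_sub_sq_le_sum_log_sub_mul_sub (hsub hx) (hsub hy)) hα.le).trans
      (mul_sum_log_sub_mul_sub_le hc hR hT (hsub hx) (hsub hy))
  obtain ⟨x, hx, hVI⟩ := exists_forall_inner_nonneg_of_strongly_monotone hne
    (isClosed_truncatedProfiles ε).isComplete (convex_truncatedProfiles ε) hL hα hmono
  -- Test the variational inequality by moving all the mass of j above the floor ε to i.
  have hswap : ∀ k i j, ε < x ⟨k, j⟩ → F x ⟨k, j⟩ ≤ F x ⟨k, i⟩ := fun k i j hj => by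
    rcases eq_or_ne i j with rfl | hij
    · exact le_rfl
    set s : ℝ := x ⟨k, j⟩ - ε
    have hs : 0 < s := sub_pos.2 hj
    set d : Profile S := EuclideanSpace.single ⟨k, i⟩ 1 - EuclideanSpace.single ⟨k, j⟩ 1 with hd
    have hda : ∀ a, (x + s • d) a = x a + s * ((if a = ⟨k, i⟩ then 1 else 0)
        - (if a = ⟨k, j⟩ then 1 else 0)) := fun a => by
      simp [hd]
    have hge : ∀ a, ε ≤ (x + s • d) a := fun a => by
      rw [hda]
      have := hx.2 a
      split_ifs with h1 h2 h2
      · linarith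
      · linarith
      · rw [h2]
        simp only [s]
        linarith
      · linarith
    have hy : x + s • d ∈ truncatedProfiles S ε := by
      refine ⟨fun l => ⟨fun m => hε.le.trans (hge ⟨l, m⟩), ?_⟩, hge⟩
      simp only [Profile.strat, hda]
      rw [Finset.sum_add_distrib, sum_eq_one_of_mem_mixedProfiles hx.1 l, ← Finset.mul_sum, Finset.sum_sub_distrib]
      have hone : ∀ i' : S k, ∑ m : S l, (if (⟨l, m⟩ : Σ k, S k) = ⟨k, i'⟩ then (1 : ℝ) else 0) =
          if l = k then 1 else 0 := fun i' => by
        by_cases hlk : l = k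
        · subst hlk
          simp
        · simp [hlk]
      rw [hone, hone, sub_self, mul_zero, add_zero]
    have h := hVI _ hy
    rw [add_sub_cancel_left, inner_smul_right, hd, inner_sub_right,
      EuclideanSpace.inner_single_right, EuclideanSpace.inner_single_right] at h
    have := nonneg_of_mul_nonneg_right (by simpa using h) hs
    linarith
  have hgt : ∀ k i, ε < x ⟨k, i⟩ := fun k i => by
    -- Some action has at least the average probability 1/|S_k| > ε, so `hswap` applies to it.
    obtain ⟨j, -, hj⟩ := Finset.exists_le_of_sum_le (s := Finset.univ)
      (f := fun _ : S k => 1 / (Fintype.card (S k) : ℝ)) (g := fun j => x ⟨k, j⟩)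
      Finset.univ_nonempty (by
        have := (hcard k).ne'
        rw [sum_eq_one_of_mem_mixedProfiles hx.1 k]
        simp only [Finset.sum_const, Finset.card_univ, nsmul_eq_mul]
        field_simp
        rfl)
    have h1 := hswap k i j ((hεcard k).trans_le hj)
    simp only [hF] at h1
    by_contra! hle
    have h2 : Real.log (x ⟨k, i⟩) < -(2 * B) / T k - Real.log (Fintype.card (S k)) := by
      have := Real.log_lt_log ((hsub hx).2 ⟨k, i⟩) (hle.trans_lt (hεlt k))
      rwa [Real.log_div (Real.exp_pos _).ne' (hcard k).ne', Real.log_exp] at this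
    have h3 : -Real.log (Fintype.card (S k)) ≤ Real.log (x ⟨k, j⟩) := by
      have := Real.log_le_log (by have := hcard k; positivity) hj
      rwa [one_div, Real.log_inv] at this
    have h4 := abs_le.1 (hRB x hx.1 ⟨k, i⟩)
    have h5 := abs_le.1 (hRB x hx.1 ⟨k, j⟩)
    have h6 : T k * (Real.log (x ⟨k, i⟩) - Real.log (x ⟨k, j⟩)) < T k * (-(2 * B) / T k) :=
      mul_lt_mul_of_pos_left (by linarith) (hT0 k)
    rw [mul_div_cancel₀ _ (hT0 k).ne'] at h6
    linarith
  exact ⟨x, hsub hx, fun k i j => le_antisymm (hswap k j i (hgt k i)) (hswap k i j (hgt k j))⟩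

end LinearRewards

/-! ### Softmax coordinates. -/

section Softmax

variable {V : Type*} {S : V → Type*} [∀ k, Fintype (S k)]

/-- The profile whose `k`-th strategy is the softmax of the `k`-th block of `z`. -/
noncomputable def softmaxProfile (z : Profile S) : Profile S :=
  WithLp.toLp 2 fun a => Real.exp (z a) / ∑ j, Real.exp (z ⟨a.1, j⟩)

theorem sum_exp_pos (z : Profile S) (a : Σ k, S k) : 0 < ∑ j, Real.exp (z ⟨a.1, j⟩) :=
  Finset.sum_pos (fun _ _ => Real.exp_pos _) ⟨a.2, Finset.mem_univ _⟩

theorem softmaxProfile_mem [∀ k, Nonempty (S k)] (z : Profile S) :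
    softmaxProfile z ∈ fullyMixedProfiles S := by
  have hpos : ∀ a, 0 < softmaxProfile z a := fun a => div_pos (Real.exp_pos _) (sum_exp_pos z a)
  refine ⟨fun k => ⟨fun i => (hpos ⟨k, i⟩).le, ?_⟩, hpos⟩
  change ∑ i, Real.exp (z ⟨k, i⟩) / ∑ j, Real.exp (z ⟨k, j⟩) = 1
  rw [← Finset.sum_div]
  exact div_self (sum_exp_pos z ⟨k, Classical.arbitrary _⟩).ne'

theorem softmaxProfile_log {x : Profile S} (hx : x ∈ fullyMixedProfiles S) :
    softmaxProfile (WithLp.toLp 2 fun a => Real.log (x a)) = x := by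
  ext a
  simp only [softmaxProfile, Real.exp_log (hx.2 _)]
  rw [sum_eq_one_of_mem_mixedProfiles hx.1, div_one]

theorem contDiff_softmaxProfile [Fintype V] : ContDiff ℝ 1 (softmaxProfile : Profile S → Profile S) := by
  rw [contDiff_euclidean]
  intro a
  refine ContDiff.div ?_ ?_ fun z => (sum_exp_pos z a).ne'
  · fun_prop
  · fun_prop

end Softmax

/-! ### Q-learning dynamics for linear rewards. -/

section QLearning

variable {V : Type*} [DecidableEq V]
  {S : V → Type*} [∀ k, Fintype (S k)] [∀ k, DecidableEq (S k)]

theorem ownPartial_perturbedPayoff {u : V → Profile S → ℝ} {T : V → ℝ} {k : V} {i : S k}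
    {x : Profile S} {r : ℝ}
    (hu : HasLineDerivAt ℝ (u k) r x (EuclideanSpace.single ⟨k, i⟩ (1 : ℝ))) (hx : ∀ a, 0 < x a) :
    ownPartial (perturbedPayoff u T) k i x = r - T k * (Real.log (x ⟨k, i⟩) + 1) := by
  refine HasLineDerivAt.lineDeriv ?_
  refine HasDerivAt.sub hu (HasDerivAt.const_mul (T k) ?_)
  have h1 : ∀ j ∈ Finset.univ, HasDerivAt (fun t : ℝ =>
      (x + t • EuclideanSpace.single (⟨k, i⟩ : Σ k, S k) (1 : ℝ)) ⟨k, j⟩ *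
        Real.log ((x + t • EuclideanSpace.single (⟨k, i⟩ : Σ k, S k) (1 : ℝ)) ⟨k, j⟩))
      (if j = i then Real.log (x ⟨k, i⟩) + 1 else 0) 0 := fun j _ => by
    by_cases hj : j = i
    · subst hj
      have h2 : HasDerivAt (fun t : ℝ => x ⟨k, j⟩ + t) 1 0 := (hasDerivAt_id' 0).const_add _
      have h3 := HasDerivAt.comp (0 : ℝ) (Real.hasDerivAt_mul_log (x := x ⟨k, j⟩ + 0)
        (by rw [add_zero]; exact (hx _).ne')) h2
      simpa [Function.comp_def] using h3
    · simpa [hj] using hasDerivAt_const (0 : ℝ) (x ⟨k, j⟩ * Real.log (x ⟨k, j⟩))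
  simpa using HasDerivAt.fun_sum h1

/-- Taking logarithms turns the softmax denominator into a block constant; conversely that constant
is recovered from the probabilities summing to 1. -/
theorem isQRE_iff_isEntropicEquilibrium {u : V → Profile S → ℝ} {T : V → ℝ}
    {R : Profile S →L[ℝ] Profile S} (hu : ∀ k i x, ownPartial u k i x = R x ⟨k, i⟩)
    (hT : ∀ k, 0 < T k) {x : Profile S} : IsQRE u T x ↔ IsEntropicEquilibrium R T x := by
  have hpos : ∀ (k : V) (i : S k), 0 < ∑ j, Real.exp (R x ⟨k, j⟩ / T k) := fun k i =>
    Finset.sum_pos (fun j _ => Real.exp_pos _) ⟨i, Finset.mem_univ i⟩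
  simp only [IsQRE, IsEntropicEquilibrium, hu]
  constructor
  · rintro ⟨hx, h⟩
    refine ⟨⟨hx, fun a => ?_⟩, fun k i j => ?_⟩
    · rw [h a.1 a.2]
      exact div_pos (Real.exp_pos _) (hpos a.1 a.2)
    · have hlog : ∀ i, T k * Real.log (x ⟨k, i⟩) - R x ⟨k, i⟩ =
          -(T k * Real.log (∑ j, Real.exp (R x ⟨k, j⟩ / T k))) := fun i => by
        rw [h k i, Real.log_div (Real.exp_pos _).ne' (hpos k i).ne', Real.log_exp, mul_sub,
          mul_div_cancel₀ _ (hT k).ne']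
        ring
      rw [hlog, hlog]
  · rintro ⟨hx, h⟩
    refine ⟨hx.1, fun k i => ?_⟩
    have hexp : ∀ j, Real.exp (R x ⟨k, j⟩ / T k) =
        x ⟨k, j⟩ * (Real.exp (R x ⟨k, i⟩ / T k) / x ⟨k, i⟩) := fun j => by
      have h1 : R x ⟨k, j⟩ / T k =
          Real.log (x ⟨k, j⟩) + (R x ⟨k, i⟩ / T k - Real.log (x ⟨k, i⟩)) := by
        have := h k i j
        have hTk := (hT k).ne'
        field_simp
        linarith
      rw [h1, Real.exp_add, Real.exp_sub, Real.exp_log (hx.2 _), Real.exp_log (hx.2 _)]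
    have hsum : ∑ j, Real.exp (R x ⟨k, j⟩ / T k) = Real.exp (R x ⟨k, i⟩ / T k) / x ⟨k, i⟩ := by
      rw [Finset.sum_congr rfl fun j _ => hexp j, ← Finset.sum_mul,
        sum_eq_one_of_mem_mixedProfiles hx.1, one_mul]
    rw [hsum, div_div_cancel₀ (Real.exp_pos _).ne']

/-- This is replicator form with fitness R x - T log x. The subtracted mean is block-constant, hence
invisible when paired with x - p. -/
theorem qldRate_eq {u : V → Profile S → ℝ} {T : V → ℝ} {R : Profile S →L[ℝ] Profile S}
    (hu : ∀ k i x, ownPartial u k i x = R x ⟨k, i⟩) {x : Profile S}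
    (hx : x ∈ fullyMixedProfiles S) (k : V) (i : S k) :
    qldRate u T k i x = R x ⟨k, i⟩ - T k * Real.log (x ⟨k, i⟩)
      - ∑ j, x ⟨k, j⟩ * (R x ⟨k, j⟩ - T k * Real.log (x ⟨k, j⟩)) := by
  have h1 : ∑ j, x ⟨k, j⟩ * Real.log (x ⟨k, j⟩ / x ⟨k, i⟩) =
      ∑ j, x ⟨k, j⟩ * Real.log (x ⟨k, j⟩) - Real.log (x ⟨k, i⟩) := by
    have : ∀ j, x ⟨k, j⟩ * Real.log (x ⟨k, j⟩ / x ⟨k, i⟩) =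
        x ⟨k, j⟩ * Real.log (x ⟨k, j⟩) - x ⟨k, j⟩ * Real.log (x ⟨k, i⟩) := fun j => by
      rw [Real.log_div (hx.2 _).ne' (hx.2 _).ne', mul_sub]
    simp only [this]
    rw [Finset.sum_sub_distrib, ← Finset.sum_mul, sum_eq_one_of_mem_mixedProfiles hx.1, one_mul]
  have h2 : ∑ j, x ⟨k, j⟩ * (R x ⟨k, j⟩ - T k * Real.log (x ⟨k, j⟩)) =
      ∑ j, x ⟨k, j⟩ * R x ⟨k, j⟩ - T k * ∑ j, x ⟨k, j⟩ * Real.log (x ⟨k, j⟩) := by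
    rw [Finset.mul_sum, ← Finset.sum_sub_distrib]
    exact Finset.sum_congr rfl fun j _ => by ring
  simp only [qldRate, hu]
  rw [h1, h2]
  ring

variable [Fintype V]

/-- Strong monotonicity of a perturbed game with linear rewards. -/
theorem stronglyMonotoneOnWith_perturbedPayoff {u : V → Profile S → ℝ} {T : V → ℝ}
    {R : Profile S →L[ℝ] Profile S} {c α : ℝ}
    (hu : ∀ k i x, HasLineDerivAt ℝ (u k) (R x ⟨k, i⟩) x (EuclideanSpace.single ⟨k, i⟩ (1 : ℝ)))
    (hc : 0 ≤ c) (hα : 0 < α) (hR : ∀ d, inner ℝ (R d) d ≤ c * ‖d‖ ^ 2)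
    (hT : ∀ k, c + α ≤ T k) :
    StronglyMonotoneOnWith (pseudoGradient (perturbedPayoff u T)) (fullyMixedProfiles S) α := by
  refine ⟨hα, fun x hx y hy => ?_⟩
  have h1 : inner ℝ (pseudoGradient (perturbedPayoff u T) x - pseudoGradient (perturbedPayoff u T) y)
      (x - y) = ∑ a, ((T a.1 * Real.log (x a) - R x a) - (T a.1 * Real.log (y a) - R y a))
        * (x a - y a) := by
    rw [EuclideanSpace.real_inner_eq_sum]
    refine Finset.sum_congr rfl fun a _ => ?_
    simp only [pseudoGradient, PiLp.sub_apply]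
    rw [ownPartial_perturbedPayoff (hu a.1 a.2 x) hx.2,
      ownPartial_perturbedPayoff (hu a.1 a.2 y) hy.2]
    ring
  rw [h1]
  exact (mul_le_mul_of_nonneg_left (norm_sub_sq_le_sum_log_sub_mul_sub hx hy) hα.le).trans
    (mul_sum_log_sub_mul_sub_le hc hR hT hx hy)

/-- The relative entropy with respect to the equilibrium is a Lyapunov function of the Q-learning
dynamics that decays exponentially. -/
theorem IsQLDSolution.tendsto {u : V → Profile S → ℝ} {T : V → ℝ}
    {R : Profile S →L[ℝ] Profile S} {c α : ℝ} (hu : ∀ k i x, ownPartial u k i x = R x ⟨k, i⟩)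
    (hc : 0 ≤ c) (hα : 0 < α) (hR : ∀ d, inner ℝ (R d) d ≤ c * ‖d‖ ^ 2)
    (hT : ∀ k, c + α ≤ T k) {p : Profile S} (hp : IsEntropicEquilibrium R T p)
    {x : ℝ → Profile S} (hx : IsQLDSolution u T x) : Tendsto x atTop (𝓝 p) := by
  -- The terms -p + x cancel in the sum but make each summand nonnegative, so estimates can be made
  -- coordinatewise.
  set D : ℝ → ℝ := fun t => ∑ a, (p a * (Real.log (p a) - Real.log (x t a)) - p a + x t a) with hD
  set D' : ℝ → ℝ := fun t => ∑ a : Σ k, S k, (x t a - p a) * qldRate u T a.1 a.2 (x t) with hD'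
  have hderiv : ∀ t, 0 ≤ t → HasDerivWithinAt D (D' t) (Set.Ici 0) t := fun t ht => by
    refine HasDerivWithinAt.fun_sum fun a _ => ?_
    obtain ⟨v, hv, hva⟩ := (hx t ht).2 a.1 a.2
    have hxa := (hx t ht).1.2 a
    have hlog := (((hv.log hxa.ne').const_sub (Real.log (p a))).const_mul (p a)).sub_const (p a)
    refine (hlog.add hv).congr_deriv ?_
    rw [← hva]
    change p a * -(v / x t a) + v = (x t a - p a) * (v / x t a)
    field_simp
    ring
  have hdecay : ∀ t, 0 ≤ t → D' t ≤ -α * D t := fun t ht => by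
    have hxt := (hx t ht).1
    have h1 := mul_sum_log_sub_mul_sub_le hc hR hT hxt hp.1
    -- The gap is the reverse relative entropy, which is nonnegative.
    have h2 : D t ≤ ∑ a, (Real.log (x t a) - Real.log (p a)) * (x t a - p a) := by
      refine Finset.sum_le_sum fun a _ => ?_
      have := half_sq_sub_le_mul_log_sub (hxt.2 a) (le_one_of_mem_fullyMixedProfiles hxt a)
        (hp.1.2 a) (le_one_of_mem_fullyMixedProfiles hp.1 a)
      linarith [sq_nonneg (x t a - p a)]
    have h3 := sum_mul_sub_eq_zero_of_block_const hxt.1 hp.1.1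
      (g := fun a => -(T a.1 * Real.log (p a) - R p a)
        - ∑ j, x t ⟨a.1, j⟩ * (R (x t) ⟨a.1, j⟩ - T a.1 * Real.log (x t ⟨a.1, j⟩)))
      (fun k i j => by simp only [hp.2 k i j])
    have h4 : D' t = -∑ a, ((T a.1 * Real.log (x t a) - R (x t) a)
          - (T a.1 * Real.log (p a) - R p a)) * (x t a - p a) := by
      rw [← add_zero (-_), ← h3, ← Finset.sum_neg_distrib, ← Finset.sum_add_distrib]
      refine Finset.sum_congr rfl fun a _ => ?_
      rw [qldRate_eq hu hxt]
      ring
    rw [h4]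
    have h5 := mul_le_mul_of_nonneg_left h2 hα.le
    linarith
  have hE : ∀ t, 0 ≤ t → HasDerivWithinAt (fun t => Real.exp (α * t) * D t)
      (Real.exp (α * t) * α * D t + Real.exp (α * t) * D' t) (Set.Ici 0) t := fun t ht => by
    have h1 : HasDerivAt (fun t : ℝ => Real.exp (α * t)) (Real.exp (α * t) * α) t := by
      simpa using ((hasDerivAt_id t).const_mul α).exp
    exact h1.hasDerivWithinAt.mul (hderiv t ht)
  have hanti : AntitoneOn (fun t => Real.exp (α * t) * D t) (Set.Ici 0) := by
    refine antitoneOn_of_hasDerivWithinAt_nonpos (convex_Ici 0)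
      (fun t ht => (hE t ht).continuousWithinAt)
      (fun t ht => (hE t (interior_subset ht)).mono interior_subset) fun t ht => ?_
    have h1 := mul_le_mul_of_nonneg_left (hdecay t (interior_subset ht)) (Real.exp_pos (α * t)).le
    linarith
  have hbound : ∀ t, 0 ≤ t → ‖x t - p‖ ≤ Real.sqrt (2 * (D 0 * Real.exp (-(α * t)))) :=
    fun t ht => by
    apply Real.le_sqrt_of_sq_le
    have h1 : ‖x t - p‖ ^ 2 / 2 ≤ D t := by
      rw [norm_sub_rev, EuclideanSpace.real_norm_sq_eq, Finset.sum_div]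
      exact Finset.sum_le_sum fun a _ => half_sq_sub_le_mul_log_sub (hp.1.2 a)
        (le_one_of_mem_fullyMixedProfiles hp.1 a) ((hx t ht).1.2 a)
        (le_one_of_mem_fullyMixedProfiles (hx t ht).1 a)
    have h2 := hanti (Set.mem_Ici.2 le_rfl) (Set.mem_Ici.2 ht) ht
    simp only [mul_zero, Real.exp_zero, one_mul] at h2
    have h3 : D t ≤ D 0 * Real.exp (-(α * t)) := by
      rw [Real.exp_neg, ← div_eq_mul_inv, le_div_iff₀ (Real.exp_pos _), mul_comm]
      exact h2
    linarith
  rw [tendsto_iff_norm_sub_tendsto_zero]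
  have hlim : Tendsto (fun t : ℝ => Real.sqrt (2 * (D 0 * Real.exp (-(α * t))))) atTop (𝓝 0) := by
    have h1 : Tendsto (fun t : ℝ => Real.exp (-(α * t))) atTop (𝓝 0) :=
      Real.tendsto_exp_neg_atTop_nhds_zero.comp (tendsto_id.const_mul_atTop hα)
    have h2 := ((h1.const_mul (D 0)).const_mul 2).sqrt
    simpa using h2
  exact squeeze_zero' (Eventually.of_forall fun t => norm_nonneg _)
    (eventually_ge_atTop 0 |>.mono hbound) hlim

/-- In logarithmic coordinates the Q-learning dynamics become a complete vector field. -/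
theorem exists_isQLDSolution [∀ k, Nonempty (S k)] {u : V → Profile S → ℝ} {T : V → ℝ}
    {R : Profile S →L[ℝ] Profile S} (hu : ∀ k i x, ownPartial u k i x = R x ⟨k, i⟩)
    {x₀ : Profile S} (hx₀ : x₀ ∈ fullyMixedProfiles S) :
    ∃ x, IsQLDSolution u T x ∧ x 0 = x₀ := by
  set A : Profile S →L[ℝ] Profile S :=
    Matrix.toEuclideanCLM (𝕜 := ℝ) (Matrix.diagonal fun a : Σ k, S k => T a.1) with hA
  have hAa : ∀ z a, A z a = T a.1 * z a := fun z a => by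
    rw [hA, Matrix.ofLp_toEuclideanCLM, Matrix.mulVec_diagonal]
  -- Softmax ignores block constants, so the mean term of the dynamics can be dropped in these
  -- coordinates; the reward term is bounded.
  have hf : ContDiff ℝ 1 fun z => R (softmaxProfile z) - A z :=
    (R.contDiff.comp contDiff_softmaxProfile).sub A.contDiff
  obtain ⟨z, hz0, hz⟩ := hf.exists_global_integralCurve
    (B := ‖R‖ * Real.sqrt (Fintype.card V)) (M := ‖A‖) (fun z =>
      (norm_sub_le _ _).trans (add_le_add ((R.le_opNorm _).trans (mul_le_mul_of_nonneg_left
        (norm_le_of_mem_mixedProfiles (softmaxProfile_mem z).1) (norm_nonneg _))) (A.le_opNorm z)))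
    (WithLp.toLp 2 fun a => Real.log (x₀ a))
  refine ⟨fun t => softmaxProfile (z t), fun t _ => ⟨softmaxProfile_mem _, fun k i => ?_⟩, by
    simp only [hz0, softmaxProfile_log hx₀]⟩
  set y := softmaxProfile (z t) with hy
  have hza : ∀ a, HasDerivAt (fun s => z s a) (R y a - T a.1 * z t a) t := fun a => by
    rw [← hAa]
    exact (EuclideanSpace.proj (𝕜 := ℝ) a).hasFDerivAt.comp_hasDerivAt t (hz t)
  have hZ : HasDerivAt (fun s => ∑ j, Real.exp (z s ⟨k, j⟩))
      (∑ j, Real.exp (z t ⟨k, j⟩) * (R y ⟨k, j⟩ - T k * z t ⟨k, j⟩)) t :=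
    HasDerivAt.fun_sum fun j _ => (hza ⟨k, j⟩).exp
  have hpos := sum_exp_pos (z t) ⟨k, i⟩
  refine ⟨_, ((hza ⟨k, i⟩).exp.div hZ hpos.ne').hasDerivWithinAt, ?_⟩
  have hlog : ∀ j, Real.log (y ⟨k, j⟩) = z t ⟨k, j⟩ - Real.log (∑ j, Real.exp (z t ⟨k, j⟩)) :=
    fun j => by
    rw [hy]
    simp only [softmaxProfile]
    rw [Real.log_div (Real.exp_pos _).ne' hpos.ne', Real.log_exp]
  have hsum1 := sum_eq_one_of_mem_mixedProfiles (softmaxProfile_mem (z t)).1 k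
  have hmean : ∑ j, y ⟨k, j⟩ * (R y ⟨k, j⟩ - T k * Real.log (y ⟨k, j⟩)) =
      (∑ j, Real.exp (z t ⟨k, j⟩) * (R y ⟨k, j⟩ - T k * z t ⟨k, j⟩)) /
        (∑ j, Real.exp (z t ⟨k, j⟩)) + T k * Real.log (∑ j, Real.exp (z t ⟨k, j⟩)) := by
    rw [Finset.sum_div, ← one_mul (T k * Real.log _), ← hsum1, Finset.sum_mul,
      ← Finset.sum_add_distrib]
    refine Finset.sum_congr rfl fun j _ => ?_
    rw [hlog j, hy]
    simp only [softmaxProfile]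
    ring
  have hya : y ⟨k, i⟩ = Real.exp (z t ⟨k, i⟩) / ∑ j, Real.exp (z t ⟨k, j⟩) := rfl
  change _ / y ⟨k, i⟩ = qldRate u T k i y
  rw [qldRate_eq hu (softmaxProfile_mem _), hmean, hlog, hya]
  have := Real.exp_pos (z t ⟨k, i⟩)
  field_simp
  ring

end QLearning

/-! ### Reward map and interaction bound of a network game. -/

namespace NetworkGame

variable {V : Type*} {S : V → Type*}

open scoped Matrix.Norms.L2Operator in
theorem interactionCoeff_nonneg [∀ k, Fintype (S k)] (𝒢 : NetworkGame V S) [∀ k, DecidableEq (S k)] :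
    0 ≤ 𝒢.interactionCoeff :=
  Real.iSup_nonneg fun _ => norm_nonneg _

variable [Fintype V]

open scoped Matrix.Norms.Operator in
theorem adjInftyNorm_nonneg [DecidableEq V] (𝒢 : NetworkGame V S) [DecidableRel 𝒢.graph.Adj] :
    0 ≤ 𝒢.adjInftyNorm := by
  unfold adjInftyNorm
  exact norm_nonneg _

theorem sum_adj_le_adjInftyNorm [DecidableEq V] (𝒢 : NetworkGame V S) [DecidableRel 𝒢.graph.Adj]
    (k : V) : ∑ l, (if 𝒢.graph.Adj k l then (1 : ℝ) else 0) ≤ 𝒢.adjInftyNorm := by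
  rw [adjInftyNorm, Matrix.linfty_opNorm_def]
  have h := Finset.le_sup (f := fun i => ∑ j, ‖𝒢.graph.adjMatrix ℝ i j‖₊) (Finset.mem_univ k)
  refine le_trans (le_of_eq ?_) (NNReal.coe_le_coe.2 h)
  rw [NNReal.coe_sum]
  refine Finset.sum_congr rfl fun l _ => ?_
  rw [SimpleGraph.adjMatrix_apply]
  split_ifs <;> simp

variable [∀ k, Fintype (S k)]

/-- The left side is x · (A^{kl} + (A^{lk})ᵀ) y; apply Cauchy–Schwarz, the operator norm and 2ab ≤
a² + b². -/
theorem dotProduct_add_dotProduct_le [∀ k, DecidableEq (S k)] (𝒢 : NetworkGame V S) {k l : V}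
    (h : 𝒢.graph.Adj k l) (x : S k → ℝ) (y : S l → ℝ) :
    x ⬝ᵥ (𝒢.A k l).mulVec y + y ⬝ᵥ (𝒢.A l k).mulVec x ≤
      𝒢.interactionCoeff * ((∑ i, x i ^ 2 + ∑ j, y j ^ 2) / 2) := by
  open scoped Matrix.Norms.L2Operator in
  have h1 : ‖𝒢.A k l + (𝒢.A l k).transpose‖ ≤ 𝒢.interactionCoeff :=
    le_ciSup (f := fun e : {e : V × V // 𝒢.graph.Adj e.1 e.2} =>
      ‖𝒢.A e.1.1 e.1.2 + (𝒢.A e.1.2 e.1.1).transpose‖) (Set.finite_range _).bddAbove ⟨(k, l), h⟩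
  open scoped Matrix.Norms.L2Operator in
  have h2 := Matrix.l2_opNorm_mulVec (𝒢.A k l + (𝒢.A l k).transpose) (WithLp.toLp 2 y)
  have h3 : x ⬝ᵥ (𝒢.A k l).mulVec y + y ⬝ᵥ (𝒢.A l k).mulVec x =
      inner ℝ (WithLp.toLp 2 x : EuclideanSpace ℝ (S k))
        (WithLp.toLp 2 ((𝒢.A k l + (𝒢.A l k).transpose).mulVec y)) := by
    rw [EuclideanSpace.real_inner_eq_sum]
    change _ = x ⬝ᵥ (𝒢.A k l + (𝒢.A l k).transpose).mulVec y
    rw [Matrix.add_mulVec, dotProduct_add, Matrix.mulVec_transpose, Matrix.dotProduct_mulVec y,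
      dotProduct_comm (Matrix.vecMul y _)]
  have h4 := real_inner_le_norm (WithLp.toLp 2 x : EuclideanSpace ℝ (S k))
    (WithLp.toLp 2 ((𝒢.A k l + (𝒢.A l k).transpose).mulVec y))
  have h5 := EuclideanSpace.real_norm_sq_eq (WithLp.toLp 2 x : EuclideanSpace ℝ (S k))
  have h6 := EuclideanSpace.real_norm_sq_eq (WithLp.toLp 2 y : EuclideanSpace ℝ (S l))
  simp only at h5 h6
  rw [h3, ← h5, ← h6]
  set a := ‖(WithLp.toLp 2 x : EuclideanSpace ℝ (S k))‖
  set b := ‖(WithLp.toLp 2 y : EuclideanSpace ℝ (S l))‖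
  have ha : 0 ≤ a := norm_nonneg _
  have hb : 0 ≤ b := norm_nonneg _
  calc _ ≤ a * (𝒢.interactionCoeff * b) :=
        h4.trans (mul_le_mul_of_nonneg_left (h2.trans (mul_le_mul_of_nonneg_right h1 hb)) ha)
    _ = 𝒢.interactionCoeff * (a * b) := by ring
    _ ≤ _ := mul_le_mul_of_nonneg_left (by nlinarith [sq_nonneg (a - b)])
        𝒢.interactionCoeff_nonneg

variable [DecidableEq V] [∀ k, DecidableEq (S k)]

/-- The linear map that sends a profile to the vector of rewards `r_{ki}`. -/
noncomputable def rewardMap (𝒢 : NetworkGame V S) [DecidableRel 𝒢.graph.Adj] :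
    Profile S →L[ℝ] Profile S :=
  Matrix.toEuclideanCLM (𝕜 := ℝ) (Matrix.of fun a b : Σ k, S k =>
    if 𝒢.graph.Adj a.1 b.1 then 𝒢.A a.1 b.1 a.2 b.2 else 0)

theorem rewardMap_apply (𝒢 : NetworkGame V S) [DecidableRel 𝒢.graph.Adj] (x : Profile S) (k : V)
    (i : S k) : 𝒢.rewardMap x ⟨k, i⟩ =
      ∑ l, if 𝒢.graph.Adj k l then (𝒢.A k l).mulVec (x.strat l) i else 0 := by
  rw [rewardMap, Matrix.ofLp_toEuclideanCLM, Matrix.mulVec, dotProduct, Fintype.sum_sigma]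
  refine Finset.sum_congr rfl fun l _ => ?_
  split_ifs with h <;> simp [h, Matrix.mulVec, dotProduct, Profile.strat]

theorem payoff_eq (𝒢 : NetworkGame V S) [DecidableRel 𝒢.graph.Adj] (k : V) (x : Profile S) :
    𝒢.payoff k x = ∑ i, x ⟨k, i⟩ * 𝒢.rewardMap x ⟨k, i⟩ := by
  simp only [payoff, rewardMap_apply, Finset.mul_sum]
  rw [Finset.sum_comm, Finset.sum_filter]
  refine Finset.sum_congr rfl fun l _ => ?_
  split_ifs with h <;> simp [dotProduct, Profile.strat]

/-- The graph has no loops, so an agent's rewards ignore its own strategy and its payoff is affine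
along its own coordinates. -/
theorem hasLineDerivAt_payoff (𝒢 : NetworkGame V S) [DecidableRel 𝒢.graph.Adj] (k : V) (i : S k)
    (x : Profile S) :
    HasLineDerivAt ℝ (𝒢.payoff k) (𝒢.rewardMap x ⟨k, i⟩) x
      (EuclideanSpace.single ⟨k, i⟩ (1 : ℝ)) := by
  have h0 : ∀ j, 𝒢.rewardMap (EuclideanSpace.single ⟨k, i⟩ (1 : ℝ)) ⟨k, j⟩ = 0 := fun j => by
    rw [rewardMap_apply]
    refine Finset.sum_eq_zero fun l _ => ?_
    split_ifs with h
    · have hs : Profile.strat (EuclideanSpace.single (⟨k, i⟩ : Σ k, S k) (1 : ℝ)) l = 0 := by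
        ext m
        simp [Profile.strat, h.ne']
      rw [hs, Matrix.mulVec_zero, Pi.zero_apply]
    · rfl
  have h1 : ∀ t : ℝ, 𝒢.payoff k (x + t • EuclideanSpace.single ⟨k, i⟩ (1 : ℝ)) =
      𝒢.payoff k x + t * 𝒢.rewardMap x ⟨k, i⟩ := fun t => by
    simp only [payoff_eq, map_add, map_smul, PiLp.add_apply, PiLp.smul_apply, h0, smul_zero,
      add_zero, add_mul, Finset.sum_add_distrib]
    simp
  have h2 : ∀ p r : ℝ, HasDerivAt (fun t : ℝ => p + t * r) r 0 := fun p r =>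
    (((hasDerivAt_id' (0 : ℝ)).mul_const r).const_add p).congr_deriv (one_mul r)
  rw [HasLineDerivAt, funext h1]
  exact h2 _ _

/-- Add the forms of (k,l) and (l,k), which doubles the total and gives the factor ½. Each agent's
squared norm is then weighted by its degree, at most ‖G‖_∞. -/
theorem inner_rewardMap_le (𝒢 : NetworkGame V S) [DecidableRel 𝒢.graph.Adj] (d : Profile S) :
    inner ℝ (𝒢.rewardMap d) d ≤ 1 / 2 * 𝒢.interactionCoeff * 𝒢.adjInftyNorm * ‖d‖ ^ 2 := by
  set b : V → V → ℝ := fun k l =>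
    if 𝒢.graph.Adj k l then d.strat k ⬝ᵥ (𝒢.A k l).mulVec (d.strat l) else 0 with hb
  set n : V → ℝ := fun k => ∑ i, d ⟨k, i⟩ ^ 2 with hn
  have hn0 : ∀ k, 0 ≤ n k := fun k => Finset.sum_nonneg fun i _ => sq_nonneg _
  set e : V → V → ℝ := fun k l => if 𝒢.graph.Adj k l then (1 : ℝ) else 0 with he
  have he' : ∀ k l, e l k = e k l := fun k l => by simp only [he, 𝒢.graph.adj_comm]
  have h1 : inner ℝ (𝒢.rewardMap d) d = ∑ k, ∑ l, b k l := by
    rw [EuclideanSpace.real_inner_eq_sum, Fintype.sum_sigma]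
    refine Finset.sum_congr rfl fun k _ => ?_
    have := 𝒢.payoff_eq k d
    rw [payoff, Finset.sum_filter] at this
    rw [hb, this]
    exact Finset.sum_congr rfl fun i _ => mul_comm _ _
  have h2 : ∀ k l, b k l + b l k ≤ 𝒢.interactionCoeff * ((n k + n l) / 2) * e k l := fun k l => by
    by_cases h : 𝒢.graph.Adj k l
    · simp only [hb, he, if_pos h, if_pos h.symm, mul_one]
      exact 𝒢.dotProduct_add_dotProduct_le h _ _
    · simp [hb, he, h, 𝒢.graph.adj_comm l k]
  have h3 : ∑ k, ∑ l, (b k l + b l k) = 2 * ∑ k, ∑ l, b k l := by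
    simp only [Finset.sum_add_distrib]
    rw [Finset.sum_comm (f := fun k l => b l k)]
    ring
  have h4 : ∑ k, ∑ l, 𝒢.interactionCoeff * ((n k + n l) / 2) * e k l =
      𝒢.interactionCoeff * ∑ k, n k * ∑ l, e k l := by
    have h5 : ∀ k l, 𝒢.interactionCoeff * ((n k + n l) / 2) * e k l =
        𝒢.interactionCoeff / 2 * (n k * e k l) + 𝒢.interactionCoeff / 2 * (n l * e l k) :=
      fun k l => by rw [he' k l]; ring
    simp only [h5, Finset.sum_add_distrib]
    rw [Finset.sum_comm (f := fun k l => 𝒢.interactionCoeff / 2 * (n l * e l k))]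
    simp only [← Finset.mul_sum]
    ring
  have h6 : ∑ k, n k * ∑ l, e k l ≤ 𝒢.adjInftyNorm * ‖d‖ ^ 2 := by
    rw [EuclideanSpace.real_norm_sq_eq, Fintype.sum_sigma, Finset.mul_sum]
    refine Finset.sum_le_sum fun k _ => ?_
    rw [mul_comm]
    exact mul_le_mul_of_nonneg_right (𝒢.sum_adj_le_adjInftyNorm k) (hn0 k)
  have h7 := Finset.sum_le_sum fun k (_ : k ∈ Finset.univ) =>
    Finset.sum_le_sum fun l (_ : l ∈ Finset.univ) => h2 k l
  rw [h3, h4] at h7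
  have h8 := mul_le_mul_of_nonneg_left h6 𝒢.interactionCoeff_nonneg
  rw [h1]
  linarith

end NetworkGame

/-! ### Assembly. -/

theorem theorem1 {V : Type*} [Fintype V] [DecidableEq V]
    {S : V → Type*} [∀ k, Fintype (S k)] [∀ k, DecidableEq (S k)] [∀ k, Nonempty (S k)]
    (𝒢 : NetworkGame V S) [DecidableRel 𝒢.graph.Adj] (T : V → ℝ)
    (hT : ∀ k, T k > 1 / 2 * 𝒢.interactionCoeff * 𝒢.adjInftyNorm) :
    (∃ α : ℝ, StronglyMonotoneOnWith (pseudoGradient (perturbedPayoff 𝒢.payoff T))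
        (fullyMixedProfiles S) α) ∧
      ∃ xbar : Profile S,
        IsQRE 𝒢.payoff T xbar ∧ (∀ y, IsQRE 𝒢.payoff T y → y = xbar) ∧
          (∀ x₀ ∈ fullyMixedProfiles S, ∃ x, IsQLDSolution 𝒢.payoff T x ∧ x 0 = x₀) ∧
            ∀ x, IsQLDSolution 𝒢.payoff T x → Tendsto x atTop (𝓝 xbar) := by
  set c : ℝ := 1 / 2 * 𝒢.interactionCoeff * 𝒢.adjInftyNorm with hc
  have hc0 : 0 ≤ c :=
    mul_nonneg (mul_nonneg (by norm_num) 𝒢.interactionCoeff_nonneg) 𝒢.adjInftyNorm_nonneg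
  -- Choosing α near 0 serves all agents at once and also covers an empty agent set, where min T_k
  -- would be undefined.
  obtain ⟨α, hα, hTα⟩ : ∃ α : ℝ, 0 < α ∧ ∀ k, c + α ≤ T k := by
    have h1 : ∀ᶠ α : ℝ in 𝓝[>] 0, ∀ k, α < T k - c :=
      eventually_all.2 fun k => eventually_nhdsWithin_of_eventually_nhds
        (eventually_lt_nhds (sub_pos.2 (hT k)))
    obtain ⟨α, h, h'⟩ := (h1.and self_mem_nhdsWithin).exists
    exact ⟨α, h', fun k => by linarith [h k]⟩
  have hT0 : ∀ k, 0 < T k := fun k => hc0.trans_lt (hT k)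
  have hu : ∀ k i x, ownPartial 𝒢.payoff k i x = 𝒢.rewardMap x ⟨k, i⟩ := fun k i x =>
    (𝒢.hasLineDerivAt_payoff k i x).lineDeriv
  have hR := 𝒢.inner_rewardMap_le
  obtain ⟨p, hp⟩ := exists_isEntropicEquilibrium hc0 hα hR hTα
  exact ⟨⟨α, stronglyMonotoneOnWith_perturbedPayoff 𝒢.hasLineDerivAt_payoff hc0 hα hR hTα⟩, p,
    (isQRE_iff_isEntropicEquilibrium hu hT0).2 hp,
    fun y hy => ((isQRE_iff_isEntropicEquilibrium hu hT0).1 hy).eq hc0 hα hR hTα hp,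
    fun x₀ hx₀ => exists_isQLDSolution hu hx₀,
    fun x hx => hx.tendsto hu hc0 hα hR hTα hp⟩
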